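/- **Cycle Lemma.** Let $K$ be a field and let $f(Y)\in K[Y]$ be a monic irreducible polynomial whose roots (in an overfield of $K$ in which $f$ splits) are pairwise distinct. Let $v$ be a discrete valuation of $K$, i.e. a map of $K$ onto $\mathbb Z\cup\{\infty\}$ with $v(a)=\infty\Leftrightarrow a=0$, $v(ab)=v(a)+v(b)$ and $v(a+b)\ge\min(v(a),v(b))$, and assume that the residue field of $v$ is algebraically closed and has the same characteristic as $K$. Let $L=K(\alpha)$ be a field obtained by adjoining to $K$ a root $\alpha$ of $f$, and let $w_1,\dots,w_h$ be the extensions of $v$ to $L$, i.e. the discrete valuations of $L$ (normalized to map onto $\mathbb Z\cup\{\infty\}$) whose valuation rings intersect $K$ in the valuation ring of $v$. Let $r_j$ be the reduced ramification exponent of $w_j$ over $v$, i.e. the unique positive integer with $w_j(a)=r_j\,v(a)$ for all $a\in K$. Suppose that 1. for every $1<j\le h$, $r_j$ and $r_1$ are coprime and $r_j\not\equiv 0 \pmod{\operatorname{char}K}$; and 2. $r_1$ is prime or $r_1\not\equiv 0\pmod{\operatorname{char}K}$ (if $\operatorname{char}K=0$, the condition $r_j\not\equiv0\pmod{\operatorname{char}K}$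 holds automatically). Then the Galois group $\operatorname{Gal}(f,K)$, regarded as the group of permutations of the roots of $f$ induced by the $K$-automorphisms of the field generated over $K$ by these roots, contains an $r_1$-cycle, i.e. a permutation which permutes some $r_1$ distinct roots cyclically and fixes all the other roots (a $1$-cycle being the identity). -/

import Mathlib

open scoped WithZero

/-- `w` is an extension to `L` of the discrete valuation `v` of `K`: `w` is a (normalized) discrete
valuation of `L`, and its valuation ring meets `K` in the valuation ring of `v`.
Valuations are written multiplicatively: `ℤᵐ⁰` is `ℤ ∪ {∞}` with the order reversed, so a valuation
of `K` onto `ℤ ∪ {∞}` is a surjective `Valuation K ℤᵐ⁰`. -/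
structure IsDiscreteExtension {K L : Type*} [Field K] [Field L] [Algebra K L]
    (v : Valuation K ℤᵐ⁰) (w : Valuation L ℤᵐ⁰) : Prop where
  surjective : Function.Surjective w
  comap_eq : w.valuationSubring.comap (algebraMap K L) = v.valuationSubring

/-- The reduced ramification exponent of `w` over `v`: the positive integer `e` such that
`w(a) = e v(a)` (additively written) for all `a` in `K`. -/
noncomputable def reducedRamificationExponent {K L : Type*} [Field K] [Field L] [Algebra K L]
    (v : Valuation K ℤᵐ⁰) (w : Valuation L ℤᵐ⁰) : ℕ :=
  sInf {e : ℕ | 0 < e ∧ ∀ a : K, w (algebraMap K L a) = v a ^ e}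

/-- For an extension of a discrete valuation, the reduced ramification exponent does exist and is
the only positive integer with its defining property. -/
theorem reducedRamificationExponent_spec {K L : Type*} [Field K] [Field L] [Algebra K L]
    {v : Valuation K ℤᵐ⁰} {w : Valuation L ℤᵐ⁰} (hv : Function.Surjective v)
    (hw : IsDiscreteExtension v w) (e : ℕ) :
    (0 < e ∧ ∀ a : K, w (algebraMap K L a) = v a ^ e) ↔ e = reducedRamificationExponent v w := by
  obtain ⟨x, hx⟩ := hv (WithZero.exp 1)
  have key : ∀ a : K, w (algebraMap K L a) ≤ 1 ↔ v a ≤ 1 := fun a => by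
    have := SetLike.ext_iff.mp hw.comap_eq a
    simpa [ValuationSubring.mem_comap, Valuation.mem_valuationSubring_iff] using this
  have hx1 : 1 < v x := by rw [hx, ← WithZero.exp_zero, WithZero.exp_lt_exp]; norm_num
  have hx0 : x ≠ 0 := by rintro rfl; simp at hx1
  have hwx1 : 1 < w (algebraMap K L x) := by
    rw [← not_le, key, not_le]; exact hx1
  have hwx0 : w (algebraMap K L x) ≠ 0 := by simpa using hx0
  have unit : ∀ a : K, v a = 1 → w (algebraMap K L a) = 1 := fun a ha => by
    have h1 := (key a).2 ha.le
    have h2 := (key a⁻¹).2 (by simp [ha])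
    have ha0 : a ≠ 0 := by rintro rfl; simp at ha
    refine le_antisymm h1 ?_
    rw [map_inv₀, map_inv₀] at h2
    have : w (algebraMap K L a) ≠ 0 := by simpa using ha0
    exact (inv_le_one₀ (zero_lt_iff.2 this)).1 h2
  have hne : ∃ e : ℕ, 0 < e ∧ ∀ a : K, w (algebraMap K L a) = v a ^ e := by
    set d := WithZero.log (w (algebraMap K L x)) with hd
    have hwx : w (algebraMap K L x) = WithZero.exp d := (WithZero.exp_log hwx0).symm
    have hdpos : 0 < d := by
      rw [hwx, ← WithZero.exp_zero, WithZero.exp_lt_exp] at hwx1; exact hwx1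
    refine ⟨d.toNat, by omega, fun a => ?_⟩
    have hdc : ((d.toNat : ℕ) : ℤ) = d := Int.toNat_of_nonneg hdpos.le
    by_cases ha : a = 0
    · subst ha
      rw [map_zero, map_zero, map_zero, zero_pow (by omega)]
    · have hva : v a ≠ 0 := by simpa using ha
      obtain ⟨m, hm⟩ : ∃ m : ℤ, v a = v x ^ m :=
        ⟨WithZero.log (v a), by rw [hx, ← WithZero.exp_zsmul, smul_eq_mul, mul_one, WithZero.exp_log hva]⟩
      have h1 : v (a * (x ^ m)⁻¹) = 1 := by
        rw [map_mul, map_inv₀, map_zpow₀, ← hm, mul_inv_cancel₀ hva]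
      have h2 := unit _ h1
      rw [map_mul, map_mul, map_inv₀, map_inv₀, map_zpow₀, map_zpow₀,
        mul_inv_eq_one₀ (zpow_ne_zero _ hwx0)] at h2
      rw [h2, hm, hx, hwx, ← zpow_natCast, hdc, ← WithZero.exp_zsmul, ← WithZero.exp_zsmul, ← WithZero.exp_zsmul]
      congr 1
      simp [mul_comm]
  have uniq : ∀ e e' : ℕ, (∀ a : K, w (algebraMap K L a) = v a ^ e) →
      (∀ a : K, w (algebraMap K L a) = v a ^ e') → e = e' := fun e e' h h' => by
    have := (h x).symm.trans (h' x)
    exact pow_right_injective₀ (by exact zero_lt_one.trans hx1) hx1.ne' this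
  have hS := Nat.sInf_mem (s := {e : ℕ | 0 < e ∧ ∀ a : K, w (algebraMap K L a) = v a ^ e}) hne
  constructor
  · exact fun h => uniq _ _ h.2 hS.2
  · rintro rfl; exact hS

/-- `σ` is an `n`-cycle: it permutes some `n` distinct elements `x₀ → x₁ → ⋯ → xₙ₋₁ → x₀` cyclically
and fixes all other elements (so a `1`-cycle is the identity). -/
def IsCycleOfLength {X : Type*} (σ : Equiv.Perm X) (n : ℕ) : Prop :=
  ∃ x : Fin n → X, Function.Injective x ∧ (∀ i, σ (x i) = x (finRotate n i)) ∧
    ∀ y, y ∉ Set.range x → σ y = y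

/-! The cycle is found inside a decomposition group. Let `N` be the splitting field, `W` a discrete
valuation of `N` lying above `w₁` along an embedding of `L` that sends `α` to a root `y₁`, and `D`
the decomposition group of `W` over `K`. No completion is needed: everything happens over the
integral closure of the valuation ring of `v` in `N`.

Orbits of `D` on the roots. An algebraically closed residue field forces trivial residue extensions,
so `e f g = |G|` together with orbit-stabilizer gives `|D| = e(W/v)`. The same count over `L`,
embedded by sending `α` to a root `y`, identifies the stabilizer of `y` with a group of order
`e(W/w)`, where `w` is the valuation induced on `L`. By multiplicativity the orbit of `y` has length
`r_w` (`card_stabilizer_mul_reducedRamificationExponent`). Roots inducing the same `w` are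
`D`-conjugate (`exists_mem_decompositionGroup_apply_eq`), so the orbits other than that of `y₁` have
lengths among the `r_j` with `j > 1`.

Structure of `D`. The tame character `σ ↦ σ π / π` modulo the maximal ideal embeds `D / P` in the
units of a field, so `D / P` is cyclic. Only the residue characteristic `p` can be a prime divisor
of `|P|` (`exists_normal_isCyclic_quotient`); for `p = 0` this makes `P` trivial.

Group theory (`exists_isCycleOfLength_toPerm`). `P` fixes every root whose orbit length is prime to
`p`, hence all roots outside the orbit of `y₁`. If `P` also fixes that orbit, a lift `c` of a
generator of `D / P` permutes each orbit cyclically, and raising `c` to the product of the other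
orbit lengths leaves one cycle of length `r₁`. Otherwise `p ∣ r₁`, so `r₁ = p` by hypothesis, and
any element of `P` moving a point of the orbit is already the cycle. -/

open scoped Pointwise

/-! ### Normalized discrete valuations and ramification exponents -/

/-- A surjective `ℤᵐ⁰`-valued valuation of a field is discrete of rank one. -/
theorem Valuation.isRankOneDiscrete_of_surjective {F : Type*} [Field F] {v : Valuation F ℤᵐ⁰}
    (hv : Function.Surjective v) : v.IsRankOneDiscrete := by
  -- The required generator of the value group must be less than one, hence `exp (-1)`.
  refine ⟨Units.mk0 (WithZero.exp (-1 : ℤ)) WithZero.exp_ne_zero, ?_, ?_⟩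
  · ext u
    constructor
    · intro _
      have : (u : ℤᵐ⁰) ∈ Set.range v \ {0} := ⟨hv _, by simp⟩
      obtain ⟨u', hu', h⟩ : (u : ℤᵐ⁰) ∈ Units.val '' _ :=
        (MonoidWithZeroHom.valueGroup_eq_range (.ofClass v)).symm ▸ this
      rwa [← Units.ext h]
    · intro _
      refine ⟨-WithZero.log (u : ℤᵐ⁰), Units.ext ?_⟩
      simp only [Units.val_zpow_eq_zpow_val, Units.val_mk0]
      rw [← WithZero.exp_zsmul]
      simp [WithZero.exp_log]
  · rw [← Units.val_lt_val]
    simp only [Units.val_mk0, Units.val_one]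
    rw [← WithZero.exp_zero, WithZero.exp_lt_exp]; norm_num

/-- The valuation ring of a discrete valuation is a discrete valuation ring. -/
theorem Valuation.isDiscreteValuationRing_of_surjective {F : Type*} [Field F] {v : Valuation F ℤᵐ⁰}
    (hv : Function.Surjective v) : IsDiscreteValuationRing v.valuationSubring := by
  have := Valuation.isRankOneDiscrete_of_surjective hv
  infer_instance

theorem IsDiscreteExtension.le_one_iff {K L : Type*} [Field K] [Field L] [Algebra K L]
    {v : Valuation K ℤᵐ⁰} {w : Valuation L ℤᵐ⁰} (hw : IsDiscreteExtension v w) (a : K) :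
    w (algebraMap K L a) ≤ 1 ↔ v a ≤ 1 := by
  have := SetLike.ext_iff.mp hw.comap_eq a
  simpa [ValuationSubring.mem_comap, Valuation.mem_valuationSubring_iff] using this

theorem isDiscreteExtension_iff {K L : Type*} [Field K] [Field L] [Algebra K L]
    {v : Valuation K ℤᵐ⁰} {w : Valuation L ℤᵐ⁰} :
    IsDiscreteExtension v w ↔
      Function.Surjective w ∧ ∀ a, w (algebraMap K L a) ≤ 1 ↔ v a ≤ 1 := by
  refine ⟨fun h => ⟨h.surjective, h.le_one_iff⟩, fun h => ⟨h.1, ?_⟩⟩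
  ext a
  simpa [ValuationSubring.mem_comap, Valuation.mem_valuationSubring_iff] using h.2 a

theorem IsDiscreteExtension.trans {K L N : Type*} [Field K] [Field L] [Field N] [Algebra K L]
    [Algebra L N] [Algebra K N] [IsScalarTower K L N] {v : Valuation K ℤᵐ⁰} {w : Valuation L ℤᵐ⁰}
    {W : Valuation N ℤᵐ⁰} (hw : IsDiscreteExtension v w) (hW : IsDiscreteExtension w W) :
    IsDiscreteExtension v W := by
  refine isDiscreteExtension_iff.2 ⟨hW.surjective, fun a => ?_⟩
  rw [IsScalarTower.algebraMap_apply K L N, hW.le_one_iff, hw.le_one_iff]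

theorem reducedRamificationExponent_pos {K L : Type*} [Field K] [Field L] [Algebra K L]
    {v : Valuation K ℤᵐ⁰} {w : Valuation L ℤᵐ⁰} (hv : Function.Surjective v)
    (hw : IsDiscreteExtension v w) : 0 < reducedRamificationExponent v w :=
  ((reducedRamificationExponent_spec hv hw _).2 rfl).1

theorem apply_algebraMap_eq_pow {K L : Type*} [Field K] [Field L] [Algebra K L]
    {v : Valuation K ℤᵐ⁰} {w : Valuation L ℤᵐ⁰} (hv : Function.Surjective v)
    (hw : IsDiscreteExtension v w) (a : K) :
    w (algebraMap K L a) = v a ^ reducedRamificationExponent v w :=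
  ((reducedRamificationExponent_spec hv hw _).2 rfl).2 a

theorem IsDiscreteExtension.lt_one_iff {K L : Type*} [Field K] [Field L] [Algebra K L]
    {v : Valuation K ℤᵐ⁰} {w : Valuation L ℤᵐ⁰} (hv : Function.Surjective v)
    (hw : IsDiscreteExtension v w) (a : K) : w (algebraMap K L a) < 1 ↔ v a < 1 := by
  rw [apply_algebraMap_eq_pow hv hw,
    pow_lt_one_iff_of_nonneg zero_le (reducedRamificationExponent_pos hv hw).ne']

theorem reducedRamificationExponent_mul {K L N : Type*} [Field K] [Field L] [Field N] [Algebra K L]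
    [Algebra L N] [Algebra K N] [IsScalarTower K L N] {v : Valuation K ℤᵐ⁰} {w : Valuation L ℤᵐ⁰}
    {W : Valuation N ℤᵐ⁰} (hv : Function.Surjective v) (hw : IsDiscreteExtension v w)
    (hW : IsDiscreteExtension w W) :
    reducedRamificationExponent v w * reducedRamificationExponent w W =
      reducedRamificationExponent v W := by
  refine (reducedRamificationExponent_spec hv (hw.trans hW) _).1
    ⟨Nat.mul_pos (reducedRamificationExponent_pos hv hw)
      (reducedRamificationExponent_pos hw.surjective hW), fun a => ?_⟩
  rw [IsScalarTower.algebraMap_apply K L N, apply_algebraMap_eq_pow hw.surjective hW,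
    apply_algebraMap_eq_pow hv hw, pow_mul]

/-- A normalized discrete valuation is determined by its valuation ring. -/
theorem Valuation.eq_of_surjective_of_le_one_iff {F : Type*} [Field F] {v w : Valuation F ℤᵐ⁰}
    (hv : Function.Surjective v) (hw : Function.Surjective w) (h : ∀ x, w x ≤ 1 ↔ v x ≤ 1) :
    v = w := by
  have hd : IsDiscreteExtension v w := isDiscreteExtension_iff.2 ⟨hw, h⟩
  have key := apply_algebraMap_eq_pow hv hd
  simp only [Algebra.algebraMap_self, RingHom.id_apply] at key
  set e := reducedRamificationExponent v w
  obtain ⟨x, hx⟩ := hw (WithZero.exp 1)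
  have h1 := key x
  have hx0 : v x ≠ 0 := by
    have : x ≠ 0 := by rintro rfl; exact WithZero.exp_ne_zero (hx.symm.trans (map_zero w))
    simpa using this
  -- Taking logarithms, `1 = e * log (v x)`, so `e` is a unit of `ℤ`.
  rw [hx, ← WithZero.exp_log hx0, ← WithZero.exp_nsmul, WithZero.exp_inj, nsmul_eq_mul] at h1
  have he : e = 1 := by
    have := Int.eq_one_or_neg_one_of_mul_eq_one h1.symm
    omega
  ext x
  rw [key x, he, pow_one]

/-- It suffices that one valuation ring is contained in the other. -/
theorem Valuation.eq_of_surjective_of_le_one_imp {F : Type*} [Field F] {v w : Valuation F ℤᵐ⁰}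
    (hv : Function.Surjective v) (hw : Function.Surjective w) (h : ∀ x, v x ≤ 1 → w x ≤ 1) :
    v = w := by
  have := Valuation.isDiscreteValuationRing_of_surjective hv
  have hle : v.valuationSubring ≤ w.valuationSubring := h
  have hne : w.valuationSubring ≠ ⊤ := by
    intro htop
    obtain ⟨x, hx⟩ := hw (WithZero.exp 1)
    have : x ∈ w.valuationSubring := by rw [htop]; trivial
    rw [Valuation.mem_valuationSubring_iff, hx, ← WithZero.exp_zero, WithZero.exp_le_exp] at this
    norm_num at this
  -- A discrete valuation ring is maximal among the proper subrings of its fraction field.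
  have heq := ValuationSubring.eq_of_le_of_ne_top _ hle hne
  refine Valuation.eq_of_surjective_of_le_one_iff hv hw fun x => ?_
  rw [← Valuation.mem_valuationSubring_iff, ← Valuation.mem_valuationSubring_iff, heq]

/-! ### Centers of valuations on a Dedekind domain -/

section Center

open IsDedekindDomain

variable {B N : Type*} [CommRing B] [Field N] [Algebra B N] [IsFractionRing B N]

/-- The center on `B` of a discrete valuation of its field of fractions that is integral on `B`. -/
def Valuation.center (W : Valuation N ℤᵐ⁰) (hW : Function.Surjective W)
    (h : ∀ b : B, W (algebraMap B N b) ≤ 1) : HeightOneSpectrum B where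
  asIdeal :=
    { carrier := {b | W (algebraMap B N b) < 1}
      add_mem' := fun {a b} ha hb => by
        simp only [Set.mem_ofPred_eq, map_add] at *
        exact W.map_add_lt ha hb
      zero_mem' := by simp
      smul_mem' := fun c x hx => by
        simp only [Set.mem_ofPred_eq, smul_eq_mul, map_mul] at *
        exact mul_lt_one_of_nonneg_of_lt_one_right (h c) zero_le hx }
  isPrime := by
    constructor
    · rw [Ideal.ne_top_iff_one]
      intro h1
      have : W (algebraMap B N 1) < 1 := h1
      simp at this
    · intro x y hxy
      by_contra! hcon
      have h1 : W (algebraMap B N x) = 1 := le_antisymm (h x) (not_lt.1 hcon.1)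
      have h2 : W (algebraMap B N y) = 1 := le_antisymm (h y) (not_lt.1 hcon.2)
      have : W (algebraMap B N (x * y)) < 1 := hxy
      simp [h1, h2] at this
  ne_bot := by
    obtain ⟨x, hx⟩ := hW (WithZero.exp (-1))
    -- The numerator of a uniformizer `a / s` is a nonzero element of the center: `W a = exp (-1) *
    -- W s < 1`.
    obtain ⟨a, s, hs, rfl⟩ := IsFractionRing.div_surjective (A := B) x
    intro hbot
    have ha : W (algebraMap B N a) < 1 := by
      have hs0 : W (algebraMap B N s) ≠ 0 := by
        have : Nontrivial B := (algebraMap B N).domain_nontrivial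
        rw [Valuation.ne_zero_iff]
        exact IsFractionRing.to_map_ne_zero_of_mem_nonZeroDivisors hs
      rw [map_div₀, div_eq_iff hs0] at hx
      rw [hx]
      refine mul_lt_one_of_nonneg_of_lt_one_left zero_le ?_ (h s)
      rw [← WithZero.exp_zero, WithZero.exp_lt_exp]; norm_num
    have ha' : a ∈ (⊥ : Ideal B) := hbot ▸ ha
    rw [Ideal.mem_bot] at ha'
    subst ha'
    simp only [map_zero, zero_div] at hx
    exact WithZero.exp_ne_zero hx.symm

theorem Valuation.mem_center {W : Valuation N ℤᵐ⁰} (hW : Function.Surjective W)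
    (h : ∀ b : B, W (algebraMap B N b) ≤ 1) (b : B) :
    b ∈ (W.center hW h).asIdeal ↔ W (algebraMap B N b) < 1 := Iff.rfl

/-- An element integral at the center is a fraction whose denominator avoids the center and so is a
`W`-unit. One valuation ring therefore contains the other, which suffices for normalized discrete
valuations. -/
theorem Valuation.center_valuation [IsDedekindDomain B] {W : Valuation N ℤᵐ⁰}
    (hW : Function.Surjective W) (h : ∀ b : B, W (algebraMap B N b) ≤ 1) :
    (W.center hW h).valuation N = W := by
  refine Valuation.eq_of_surjective_of_le_one_imp ((W.center hW h).valuation_surjective N) hW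
    fun x hx => ?_
  obtain ⟨n, d, hnd⟩ := HeightOneSpectrum.exists_primeCompl_mul_eq_of_integer _ x hx
  have hd : W (algebraMap B N d) = 1 :=
    le_antisymm (h _) (not_lt.1 fun h' => d.2 ((Valuation.mem_center hW h _).2 h'))
  have := congrArg W hnd
  rw [map_mul, hd, mul_one] at this
  rw [this]; exact h n

/-- Discrete valuations with the same center agree. -/
theorem Valuation.eq_of_lt_one_iff_of_integral [IsDedekindDomain B] {W W' : Valuation N ℤᵐ⁰}
    (hW : Function.Surjective W) (hW' : Function.Surjective W')
    (h : ∀ b : B, W (algebraMap B N b) ≤ 1) (h' : ∀ b : B, W' (algebraMap B N b) ≤ 1)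
    (heq : ∀ b : B, W (algebraMap B N b) < 1 ↔ W' (algebraMap B N b) < 1) : W = W' := by
  have : W.center hW h = W'.center hW' h' := by
    ext b
    exact heq b
  rw [← Valuation.center_valuation hW h, this, Valuation.center_valuation hW' h']

end Center

/-! ### Extensions of `v` as primes of the integral closure -/

section Bridge

open IsDedekindDomain

variable {F N : Type*} [Field F] [Field N] [Algebra F N] {v : Valuation F ℤᵐ⁰}

/-- A discrete extension of `v` is integral on the integral closure of the valuation ring of `v`. -/
theorem IsDiscreteExtension.le_one_of_integral {W : Valuation N ℤᵐ⁰} (hW : IsDiscreteExtension v W)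
    (b : integralClosure v.valuationSubring N) : W (algebraMap _ N b) ≤ 1 := by
  have hb : IsIntegral v.valuationSubring (b : N) := b.2
  have : IsIntegral W.integer (b : N) := by
    let f : v.valuationSubring →+* W.integer :=
      { toFun := fun a => ⟨algebraMap F N a, (hW.le_one_iff _).2 a.2⟩
        map_one' := by ext; simp
        map_mul' := fun _ _ => by ext; simp
        map_zero' := by ext; simp
        map_add' := fun _ _ => by ext; simp }
    obtain ⟨q, hq, hq0⟩ := hb
    refine ⟨q.map f, hq.map f, ?_⟩
    rw [Polynomial.eval₂_map]
    exact hq0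
  exact (Valuation.integer.integers W).mem_of_integral this

theorem isTorsionFree_integralClosure (v : Valuation F ℤᵐ⁰) (N : Type*) [Field N] [Algebra F N] :
    Module.IsTorsionFree v.valuationSubring (integralClosure v.valuationSubring N) := by
  have : FaithfulSMul v.valuationSubring N := by
    rw [faithfulSMul_iff_algebraMap_injective]
    exact (algebraMap F N).injective.comp Subtype.val_injective
  have : Module.IsTorsionFree v.valuationSubring N := inferInstance
  exact Subalgebra.instIsTorsionFree _

/-- The decomposition group of a valuation of `N` over `F`. -/
def Valuation.decompositionGroup (F : Type*) {N : Type*} [Field F] [Field N] [Algebra F N]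
    (W : Valuation N ℤᵐ⁰) : Subgroup (N ≃ₐ[F] N) where
  carrier := {σ | ∀ x, W (σ x) = W x}
  mul_mem' := fun {σ τ} hσ hτ x => (hσ (τ x)).trans (hτ x)
  one_mem' := fun _ => rfl
  inv_mem' := fun {σ} hσ x => by
    rw [← hσ (σ⁻¹ x)]
    exact congrArg W (AlgEquiv.apply_symm_apply σ x)

theorem IsDiscreteExtension.liesOver {W : Valuation N ℤᵐ⁰} (hv : Function.Surjective v)
    (hW : IsDiscreteExtension v W)
    [IsFractionRing (integralClosure v.valuationSubring N) N] :
    (W.center hW.surjective hW.le_one_of_integral).asIdeal.LiesOver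
      (v.center hv (B := v.valuationSubring) fun b => b.2).asIdeal := by
  constructor
  ext a
  exact (hW.lt_one_iff hv a).symm

variable [FiniteDimensional F N]

theorem isFractionRing_integralClosure (v : Valuation F ℤᵐ⁰) :
    IsFractionRing (integralClosure v.valuationSubring N) N :=
  integralClosure.isFractionRing_of_finite_extension F N

variable [Algebra.IsSeparable F N]

theorem isDedekindDomain_integralClosure (hv : Function.Surjective v) :
    IsDedekindDomain (integralClosure v.valuationSubring N) := by
  have := Valuation.isDiscreteValuationRing_of_surjective hv
  exact IsIntegralClosure.isDedekindDomain v.valuationSubring F N _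

theorem finite_integralClosure (hv : Function.Surjective v) :
    Module.Finite v.valuationSubring (integralClosure v.valuationSubring N) := by
  have := Valuation.isDiscreteValuationRing_of_surjective hv
  exact IsIntegralClosure.finite v.valuationSubring F N _

/-- A discrete valuation extends to every finite separable extension. -/
theorem exists_isDiscreteExtension (N : Type*) [Field N] [Algebra F N] [FiniteDimensional F N]
    [Algebra.IsSeparable F N] (hv : Function.Surjective v) :
    ∃ W : Valuation N ℤᵐ⁰, IsDiscreteExtension v W := by
  have := Valuation.isDiscreteValuationRing_of_surjective hv
  have := isDedekindDomain_integralClosure (N := N) hv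
  have := isFractionRing_integralClosure (N := N) v
  have := isTorsionFree_integralClosure v N
  have h : ∀ b : v.valuationSubring, v (algebraMap _ F b) ≤ 1 := fun b => b.2
  let p := v.center hv h
  have hp : p.valuation F = v := Valuation.center_valuation hv h
  obtain ⟨Q, -, hQ, hQp⟩ := Ideal.exists_ideal_over_prime_of_isIntegral
    (S := integralClosure v.valuationSubring N) p.asIdeal ⊥ (by simp)
  have hover : Q.LiesOver p.asIdeal := ⟨hQp.symm⟩
  let q : HeightOneSpectrum (integralClosure v.valuationSubring N) :=
    ⟨Q, hQ, by
      rintro rfl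
      exact p.ne_bot (by rw [← hQp]; simp)⟩
  have hover : q.asIdeal.LiesOver p.asIdeal := hover
  refine ⟨q.valuation N, isDiscreteExtension_iff.2 ⟨q.valuation_surjective N, fun a => ?_⟩⟩
  -- On `F` the `q`-adic valuation is the `p`-adic one raised to the ramification index; a nonzero
  -- power does not change the condition `≤ 1`.
  rw [← HeightOneSpectrum.valuation_liesOver N p q a, hp, pow_le_one_iff_of_nonneg zero_le]
  exact Ideal.IsDedekindDomain.ramificationIdx'_ne_zero_of_liesOver _ p.ne_bot

variable [IsGalois F N]

/-- The Galois group permutes the extensions of a discrete valuation transitively. -/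
theorem exists_algEquiv_apply_eq {W W' : Valuation N ℤᵐ⁰} (hv : Function.Surjective v)
    (hW : IsDiscreteExtension v W) (hW' : IsDiscreteExtension v W') :
    ∃ σ : N ≃ₐ[F] N, ∀ x, W' (σ x) = W x := by
  have := Valuation.isDiscreteValuationRing_of_surjective hv
  have := isDedekindDomain_integralClosure (N := N) hv
  have := isFractionRing_integralClosure (N := N) v
  have := isTorsionFree_integralClosure v N
  have := hW.liesOver hv
  have := hW'.liesOver hv
  have : IsGaloisGroup (N ≃ₐ[F] N) v.valuationSubring (integralClosure v.valuationSubring N) :=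
    IsGaloisGroup.of_isFractionRing _ _ _ F N
  obtain ⟨σ, hσ⟩ := Ideal.exists_smul_eq_of_isGaloisGroup
    (v.center hv (B := v.valuationSubring) fun b => b.2).asIdeal
    (W.center hW.surjective hW.le_one_of_integral).asIdeal
    (W'.center hW'.surjective hW'.le_one_of_integral).asIdeal (N ≃ₐ[F] N)
  refine ⟨σ, fun x => ?_⟩
  have key : W'.comap (σ : N →+* N) = W := by
    refine Valuation.eq_of_lt_one_iff_of_integral
      (B := integralClosure v.valuationSubring N)
      (hW'.surjective.comp σ.surjective) hW.surjective (fun b => ?_)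
      hW.le_one_of_integral (fun b => ?_)
    · exact hW'.le_one_of_integral (σ • b)
    · have : σ • b ∈ (W'.center hW'.surjective hW'.le_one_of_integral).asIdeal ↔
          b ∈ (W.center hW.surjective hW.le_one_of_integral).asIdeal := by
        rw [← hσ, Ideal.smul_mem_pointwise_smul_iff]
      exact this
  exact congrArg (fun V : Valuation N ℤᵐ⁰ => V x) key

set_option synthInstance.maxHeartbeats 100000 in
/-- If every residue class is represented in the base field, then the decomposition group has as
many elements as the reduced ramification exponent. -/
theorem card_decompositionGroup {W : Valuation N ℤᵐ⁰} (hv : Function.Surjective v)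
    (hW : IsDiscreteExtension v W)
    (hres : ∀ x, W x ≤ 1 → ∃ a : F, W (x - algebraMap F N a) < 1) :
    Nat.card (W.decompositionGroup F) = reducedRamificationExponent v W := by
  have := Valuation.isDiscreteValuationRing_of_surjective hv
  have := isDedekindDomain_integralClosure (N := N) hv
  have := isFractionRing_integralClosure (N := N) v
  have := isTorsionFree_integralClosure v N
  have := finite_integralClosure (N := N) hv
  have : IsGaloisGroup (N ≃ₐ[F] N) v.valuationSubring (integralClosure v.valuationSubring N) :=
    IsGaloisGroup.of_isFractionRing _ _ _ F N
  set p := v.center hv (B := v.valuationSubring) fun b => b.2 with hp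
  set q := W.center hW.surjective hW.le_one_of_integral with hq
  have hqp : q.asIdeal.LiesOver p.asIdeal := hW.liesOver hv
  have := p.isMaximal
  have := q.isMaximal
  have hstab : MulAction.stabilizer (N ≃ₐ[F] N) q.asIdeal = W.decompositionGroup F := by
    ext σ
    rw [MulAction.mem_stabilizer_iff]
    constructor
    · intro hσ x
      have key : W.comap (σ : N →+* N) = W := by
        refine Valuation.eq_of_lt_one_iff_of_integral
          (B := integralClosure v.valuationSubring N)
          (hW.surjective.comp σ.surjective) hW.surjective (fun b => ?_)
          hW.le_one_of_integral (fun b => ?_)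
        · exact hW.le_one_of_integral (σ • b)
        · have : σ • b ∈ q.asIdeal ↔ b ∈ q.asIdeal := by
            conv_lhs => rw [← hσ, Ideal.smul_mem_pointwise_smul_iff]
          exact this
      exact congrArg (fun V : Valuation N ℤᵐ⁰ => V x) key
    · intro hσ
      have h : ∀ b, σ • b ∈ q.asIdeal ↔ b ∈ q.asIdeal := fun b => by
        have := hσ (b : N)
        rw [Valuation.mem_center, Valuation.mem_center]
        exact Iff.of_eq (congrArg (· < 1) this)
      ext b
      rw [Ideal.mem_pointwise_smul_iff_inv_smul_mem, ← h, smul_inv_smul]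
  -- The orbit of `q` consists of all primes over `p`, so orbit-stabilizer reads `g * |D| = g * (e *
  -- f)`, and `g` cancels.
  have horb : MulAction.orbit (N ≃ₐ[F] N) q.asIdeal = p.asIdeal.primesOver _ :=
    Algebra.IsInvariant.orbit_eq_primesOver v.valuationSubring _ (N ≃ₐ[F] N) p.asIdeal q.asIdeal
  have hcard := Ideal.ncard_primesOver_mul_ramificationIdxIn_mul_inertiaDegIn p.asIdeal
    (integralClosure v.valuationSubring N) (N ≃ₐ[F] N)
  have hos := Nat.card_congr (MulAction.orbitProdStabilizerEquivGroup (N ≃ₐ[F] N) q.asIdeal)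
  rw [Nat.card_prod, ← hcard, horb, hstab, Nat.card_coe_set_eq] at hos
  have hpos : 0 < (p.asIdeal.primesOver (integralClosure v.valuationSubring N)).ncard := by
    refine Nat.pos_of_ne_zero fun h0 => ?_
    rw [h0, zero_mul] at hcard
    exact Nat.card_pos.ne hcard
  rw [Nat.eq_of_mul_eq_mul_left hpos hos,
    Ideal.ramificationIdxIn_eq_ramificationIdx p.asIdeal q.asIdeal (N ≃ₐ[F] N),
    Ideal.inertiaDegIn_eq_inertiaDeg p.asIdeal q.asIdeal (N ≃ₐ[F] N),
    ← Ideal.ramificationIdx'_eq_ramificationIdx p.asIdeal q.asIdeal p.ne_bot,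
    Ideal.inertiaDeg_eq_of_isMaximal p.asIdeal q.asIdeal]
  -- By `hres`, every residue class at `q` comes from the base, so `1` spans the residue field.
  have hf : Module.finrank (v.valuationSubring ⧸ p.asIdeal)
      (integralClosure v.valuationSubring N ⧸ q.asIdeal) = 1 := by
    refine finrank_eq_one 1 one_ne_zero fun b => ?_
    obtain ⟨b, rfl⟩ := Ideal.Quotient.mk_surjective b
    obtain ⟨a, ha⟩ := hres (b : N) (hW.le_one_of_integral b)
    have ha1 : v a ≤ 1 := by
      rw [← hW.le_one_iff]
      have : algebraMap F N a = b - (b - algebraMap F N a) := by ring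
      rw [this]
      exact (W.map_sub _ _).trans (max_le (hW.le_one_of_integral b) ha.le)
    refine ⟨Ideal.Quotient.mk _ (⟨a, ha1⟩ : v.valuationSubring), ?_⟩
    rw [Algebra.smul_def, mul_one, Ideal.Quotient.algebraMap_mk_of_liesOver, eq_comm,
      Ideal.Quotient.mk_eq_mk_iff_sub_mem]
    exact ha
  rw [hf, mul_one]
  refine (reducedRamificationExponent_spec hv hW _).1 ⟨Nat.pos_of_ne_zero
    (Ideal.IsDedekindDomain.ramificationIdx'_ne_zero_of_liesOver _ p.ne_bot), fun a => ?_⟩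
  have h1 : p.valuation F a = v a :=
    congrArg (fun V : Valuation F ℤᵐ⁰ => V a) (Valuation.center_valuation hv _)
  have h2 : q.valuation N (algebraMap F N a) = W (algebraMap F N a) :=
    congrArg (fun V : Valuation N ℤᵐ⁰ => V _) (Valuation.center_valuation hW.surjective _)
  rw [← h1, HeightOneSpectrum.valuation_liesOver N p q a, h2]

end Bridge

/-! ### Triviality of the residue extension -/

section Residue

variable {K N : Type*} [Field K] [Field N] [Algebra K N] {v : Valuation K ℤᵐ⁰}

/-- If the residue field of `v` is algebraically closed, then every residue class of an extension
of `v` to an algebraic extension is represented in the base field. -/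
theorem exists_sub_lt_one_of_isAlgClosed [FiniteDimensional K N] [Algebra.IsSeparable K N]
    {W : Valuation N ℤᵐ⁰}
    (hv : Function.Surjective v) (hW : IsDiscreteExtension v W)
    [IsAlgClosed (IsLocalRing.ResidueField v.valuationSubring)] (x : N) (hx : W x ≤ 1) :
    ∃ a : K, W (x - algebraMap K N a) < 1 := by
  classical
  let i : v.valuationSubring →+* W.valuationSubring :=
    { toFun := fun a => ⟨algebraMap K N a, (hW.le_one_iff _).2 a.2⟩
      map_one' := by ext; simp
      map_mul' := fun _ _ => by ext; simp
      map_zero' := by ext; simp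
      map_add' := fun _ _ => by ext; simp }
  have hnonunit : ∀ a : v.valuationSubring, IsLocalRing.residue _ a = 0 ↔ v a < 1 := fun a => by
    rw [IsLocalRing.residue_eq_zero_iff, Valuation.mem_maximalIdeal_iff]
  have hnonunit' : ∀ a : W.valuationSubring, IsLocalRing.residue _ a = 0 ↔ W a < 1 := fun a => by
    rw [IsLocalRing.residue_eq_zero_iff, Valuation.mem_maximalIdeal_iff]
  let j : IsLocalRing.ResidueField v.valuationSubring →+*
      IsLocalRing.ResidueField W.valuationSubring :=
    Ideal.Quotient.lift _ ((IsLocalRing.residue _).comp i) fun a ha => by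
      have h1 : v a < 1 := (hnonunit a).1 (Ideal.Quotient.eq_zero_iff_mem.2 ha)
      exact (hnonunit' _).2 ((hW.lt_one_iff hv _).2 h1)
  have hj : ∀ a, j (IsLocalRing.residue _ a) = IsLocalRing.residue _ (i a) := fun a => rfl
  let : Algebra (IsLocalRing.ResidueField v.valuationSubring)
    (IsLocalRing.ResidueField W.valuationSubring) := j.toAlgebra
  -- Reducing an integral equation makes the class of `b` algebraic over the algebraically closed
  -- residue field, hence a member of it.
  have hint : ∀ b : integralClosure v.valuationSubring N,
      ∃ a : IsLocalRing.ResidueField v.valuationSubring,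
      j a = IsLocalRing.residue W.valuationSubring ⟨b, hW.le_one_of_integral b⟩ := fun b => by
    set b' : W.valuationSubring := ⟨b, hW.le_one_of_integral b⟩
    have h1 : IsIntegral (IsLocalRing.ResidueField v.valuationSubring)
        (IsLocalRing.residue W.valuationSubring b') := by
      obtain ⟨q, hq, hq0⟩ := b.2
      refine ⟨q.map (IsLocalRing.residue _), hq.map _, ?_⟩
      have h2 : q.eval₂ i b' = 0 := by
        apply W.valuationSubring.subtype_injective
        rw [Polynomial.hom_eval₂, map_zero, ← hq0]
        rfl
      have h3 := congrArg (IsLocalRing.residue W.valuationSubring) h2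
      rw [Polynomial.hom_eval₂, map_zero] at h3
      rw [Polynomial.eval₂_map]
      exact h3
    exact minpoly.mem_range_of_degree_eq_one _ _
      (IsAlgClosed.degree_eq_one_of_irreducible _ (minpoly.irreducible h1))
  have := isDedekindDomain_integralClosure (N := N) hv
  have := isFractionRing_integralClosure (N := N) v
  have hQ := Valuation.center_valuation hW.surjective hW.le_one_of_integral
  -- A general `W`-integral `x` is a fraction `n / d` of integral elements with `d` a unit at the
  -- center, so its class is the quotient of their classes.
  obtain ⟨n, d, hnd⟩ := IsDedekindDomain.HeightOneSpectrum.exists_primeCompl_mul_eq_of_integer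
    (W.center hW.surjective hW.le_one_of_integral) x (by rwa [hQ])
  obtain ⟨a, ha⟩ := hint n
  obtain ⟨c, hc⟩ := hint d
  obtain ⟨e, he⟩ := IsLocalRing.residue_surjective (a / c)
  refine ⟨e, ?_⟩
  have hd : IsLocalRing.residue W.valuationSubring ⟨d.1, hW.le_one_of_integral d.1⟩ ≠ 0 := by
    rw [ne_eq, hnonunit']
    exact d.2
  have hx' : IsLocalRing.residue W.valuationSubring ⟨x, hx⟩ = IsLocalRing.residue _ (i e) := by
    rw [← hj, he, map_div₀, ha, hc, eq_div_iff hd, ← map_mul]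
    congr 1
    exact Subtype.ext hnd
  rw [← sub_eq_zero, ← map_sub, hnonunit'] at hx'
  exact hx'

end Residue

/-! ### The tame character and wild inertia -/

section WildInertia

variable {K N : Type*} [Field K] [Field N] [Algebra K N] {W : Valuation N ℤᵐ⁰}

/-- The units congruent to one. -/
def Valuation.oneUnits (W : Valuation N ℤᵐ⁰) : Subgroup Nˣ where
  carrier := {u | W (u - 1) < 1}
  one_mem' := by simp
  mul_mem' := fun {a b} ha hb => by
    have h : ((a * b : Nˣ) : N) - 1 = (a - 1) * (b - 1) + ((a - 1) + (b - 1)) := by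
      push_cast; ring
    simp only [Set.mem_ofPred_eq] at *
    rw [h]
    refine W.map_add_lt ?_ (W.map_add_lt ha hb)
    rw [map_mul]
    exact mul_lt_one_of_nonneg_of_lt_one_left zero_le ha hb.le
  inv_mem' := fun {a} ha => by
    simp only [Set.mem_ofPred_eq] at *
    have h1 : W a = 1 := by
      have := W.map_one_add_of_lt ha
      rwa [add_sub_cancel] at this
    have h : ((a⁻¹ : Nˣ) : N) - 1 = -((a : N)⁻¹ * (a - 1)) := by
      rw [mul_sub, inv_mul_cancel₀ a.ne_zero]; push_cast; ring
    rw [h, Valuation.map_neg, map_mul, map_inv₀, h1, inv_one, one_mul]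
    exact ha

theorem Valuation.mem_oneUnits {u : Nˣ} : u ∈ W.oneUnits ↔ W (u - 1) < 1 := Iff.rfl

/-- The map `y ↦ σ y / y`. -/
def AlgEquiv.twist (σ : N ≃ₐ[K] N) : Nˣ →* Nˣ where
  toFun y := Units.map (σ : N →* N) y / y
  map_one' := by simp
  map_mul' := fun a b => by rw [map_mul, mul_div_mul_comm]

theorem AlgEquiv.coe_twist (σ : N ≃ₐ[K] N) (y : Nˣ) : (σ.twist y : N) = σ y / y := by
  simp [AlgEquiv.twist]

theorem AlgEquiv.twist_mem_oneUnits_iff {σ : N ≃ₐ[K] N} {y : Nˣ} :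
    σ.twist y ∈ W.oneUnits ↔ W (σ y - y) < W y := by
  have hy : 0 < W (y : N) := by
    rw [zero_lt_iff, Valuation.ne_zero_iff]; exact y.ne_zero
  rw [Valuation.mem_oneUnits, AlgEquiv.coe_twist, div_sub_one y.ne_zero, map_div₀,
    div_lt_one₀ hy]

/-- The decomposition group acts trivially on the residue field, if this is represented in the
base field. -/
theorem apply_sub_lt_one_of_mem_decompositionGroup
    (hres : ∀ x, W x ≤ 1 → ∃ a : K, W (x - algebraMap K N a) < 1) {σ : N ≃ₐ[K] N}
    (hσ : σ ∈ W.decompositionGroup K) {u : N} (hu : W u ≤ 1) : W (σ u - u) < 1 := by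
  obtain ⟨a, ha⟩ := hres u hu
  have h : σ u - u = σ (u - algebraMap K N a) - (u - algebraMap K N a) := by
    rw [map_sub, AlgEquiv.commutes]; ring
  rw [h]
  exact W.map_sub_lt (by rwa [hσ]) ha

/-- Write `y` as a unit times a power of `π`. The twist is multiplicative, and on the unit part it
is a one-unit because `σ` acts trivially on residues. Thus the kernel of the tame character acts
wildly on every element, not just on `π`. -/
theorem twist_mem_oneUnits_of_apply_uniformizer
    (hres : ∀ x, W x ≤ 1 → ∃ a : K, W (x - algebraMap K N a) < 1) {σ : N ≃ₐ[K] N}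
    (hσ : σ ∈ W.decompositionGroup K) {π : Nˣ} (hπ : W π = WithZero.exp (-1))
    (h : σ.twist π ∈ W.oneUnits) (y : Nˣ) : σ.twist y ∈ W.oneUnits := by
  set n : ℤ := - WithZero.log (W y) with hn
  have hy0 : W (y : N) ≠ 0 := by rw [Valuation.ne_zero_iff]; exact y.ne_zero
  have hu : W ((y * π ^ (-n) : Nˣ) : N) = 1 := by
    push_cast
    rw [map_mul, map_zpow₀, hπ, ← WithZero.exp_zsmul, ← WithZero.exp_log hy0, ← WithZero.exp_add,
      ← WithZero.exp_zero, hn]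
    simp
  have : y = (y * π ^ (-n)) * π ^ n := by group
  rw [this, map_mul, map_zpow]
  refine mul_mem ?_ (zpow_mem h n)
  rw [AlgEquiv.twist_mem_oneUnits_iff, hu]
  exact apply_sub_lt_one_of_mem_decompositionGroup hres hσ hu.le

/-- The tame character of the decomposition group. -/
noncomputable def tameCharacter
    (hres : ∀ x, W x ≤ 1 → ∃ a : K, W (x - algebraMap K N a) < 1) (π : Nˣ) :
    W.decompositionGroup K →* IsLocalRing.ResidueField W.valuationSubring where
  toFun σ := IsLocalRing.residue W.valuationSubring ⟨σ.1.twist π, by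
    rw [Valuation.mem_valuationSubring_iff, AlgEquiv.coe_twist, map_div₀, σ.2,
      div_self (by rw [Valuation.ne_zero_iff]; exact π.ne_zero)]⟩
  map_one' := by
    rw [← map_one (IsLocalRing.residue _)]
    congr 1
    ext
    simp [AlgEquiv.coe_twist]
  map_mul' := fun σ τ => by
    rw [← map_mul, ← sub_eq_zero, ← map_sub, IsLocalRing.residue_eq_zero_iff,
      Valuation.mem_maximalIdeal_iff]
    simp only [AddSubgroupClass.coe_sub, MulMemClass.coe_mul, AlgEquiv.coe_twist]
    have hσπ : σ.1 (π : N) ≠ 0 := by simp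
    -- The twist is only a crossed homomorphism; its defect contains `σ u - u` for the unit `u = τ π
    -- / π`, which vanishes in the residue field.
    have h : (σ.1 * τ.1) (π : N) / π - σ.1 π / π * (τ.1 π / π) =
        (σ.1 (τ.1 π / π) - τ.1 π / π) * (σ.1 π / π) := by
      rw [AlgEquiv.mul_apply, map_div₀]
      field_simp
    have hv : ∀ σ : W.decompositionGroup K, W (σ.1 (π : N) / π) = 1 := fun σ => by
      rw [map_div₀, σ.2, div_self (by rw [Valuation.ne_zero_iff]; exact π.ne_zero)]
    rw [h, map_mul, hv, mul_one]
    exact apply_sub_lt_one_of_mem_decompositionGroup hres σ.2 (hv τ).le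

theorem tameCharacter_eq_one_iff
    (hres : ∀ x, W x ≤ 1 → ∃ a : K, W (x - algebraMap K N a) < 1) (π : Nˣ)
    (σ : W.decompositionGroup K) : tameCharacter hres π σ = 1 ↔ σ.1.twist π ∈ W.oneUnits := by
  rw [← sub_eq_zero, ← map_one (IsLocalRing.residue W.valuationSubring)]
  change IsLocalRing.residue _ _ - _ = 0 ↔ _
  rw [← map_sub, IsLocalRing.residue_eq_zero_iff, Valuation.mem_maximalIdeal_iff]
  rfl

/-- An automorphism of prime order `l` that moves every element by an element of smaller absolute
value exists only if `l` is zero in the residue field. -/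
theorem map_natCast_lt_one_of_twist_mem_oneUnits {σ : N ≃ₐ[K] N} {l : ℕ} (hl : σ ^ l = 1)
    (hσ1 : σ ≠ 1) (hσ : ∀ i : ℕ, ∀ y : Nˣ, (σ ^ i).twist y ∈ W.oneUnits) : W (l : N) < 1 := by
  obtain ⟨x, hx⟩ : ∃ x, σ x ≠ x := by
    by_contra! h
    exact hσ1 (AlgEquiv.ext h)
  set y : N := σ x - x with hy
  have hy0 : y ≠ 0 := sub_ne_zero.2 hx
  have hWy : W y ≠ 0 := by rwa [Valuation.ne_zero_iff]
  -- The trace of `y = σ x - x` telescopes to zero. Hence `l * y` is minus a sum of differences `σ ^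
  -- i y - y`, each smaller than `y`, which forces `W l < 1`.
  have hsum : ∑ i ∈ Finset.range l, (σ ^ i) y = 0 := by
    have h1 : ∀ i, (σ ^ i) y = (σ ^ (i + 1)) x - (σ ^ i) x := fun i => by
      rw [hy, map_sub, pow_succ, AlgEquiv.mul_apply]
    simp_rw [h1]
    rw [Finset.sum_range_sub (fun i => (σ ^ i) x), hl, pow_zero, sub_self]
  have h2 : (l : N) * y = - ∑ i ∈ Finset.range l, ((σ ^ i) y - y) := by
    rw [Finset.sum_sub_distrib, hsum]
    simp
  have h3 : W ((l : N) * y) < W y := by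
    rw [h2, Valuation.map_neg]
    refine W.map_sum_lt hWy fun i _ => ?_
    exact AlgEquiv.twist_mem_oneUnits_iff.1 (hσ i (Units.mk0 y hy0))
  rw [map_mul] at h3
  by_contra! h4
  exact absurd h3 (not_lt.2 (le_mul_of_one_le_left zero_le h4))

/-- The decomposition group is an extension of a cyclic group by a group whose order is a power of
the residue characteristic. -/
theorem exists_normal_isCyclic_quotient [FiniteDimensional K N] {v : Valuation K ℤᵐ⁰}
    (hv : Function.Surjective v) (hW : IsDiscreteExtension v W)
    (hres : ∀ x, W x ≤ 1 → ∃ a : K, W (x - algebraMap K N a) < 1) :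
    ∃ (P : Subgroup (W.decompositionGroup K)) (_ : P.Normal),
      IsCyclic (W.decompositionGroup K ⧸ P) ∧ ∀ l : ℕ, l.Prime → l ∣ Nat.card P →
        l = ringChar (IsLocalRing.ResidueField v.valuationSubring) := by
  obtain ⟨π', hπ'⟩ := hW.surjective (WithZero.exp (-1))
  have hπ0 : π' ≠ 0 := by
    rintro rfl
    exact WithZero.exp_ne_zero (hπ'.symm.trans (map_zero W))
  set π : Nˣ := Units.mk0 π' hπ0
  have hπ : W (π : N) = WithZero.exp (-1) := hπ'
  set θ := (tameCharacter hres π).toHomUnits with hθ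
  have hker : ∀ σ, σ ∈ θ.ker ↔ σ.1.twist π ∈ W.oneUnits := fun σ => by
    rw [← tameCharacter_eq_one_iff hres, MonoidHom.mem_ker, Units.ext_iff]
    rfl
  refine ⟨θ.ker, inferInstance, ?_, fun l hl hdvd => ?_⟩
  · refine isCyclic_of_injective_ringHom
      ((Units.coeHom (IsLocalRing.ResidueField W.valuationSubring)).comp
        (QuotientGroup.kerLift θ)) ?_
    exact Units.val_injective.comp (QuotientGroup.kerLift_injective θ)
  · have : Fact l.Prime := ⟨hl⟩
    obtain ⟨σ, hσ⟩ := exists_prime_orderOf_dvd_card' l hdvd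
    have h1 : W (l : N) < 1 := by
      refine map_natCast_lt_one_of_twist_mem_oneUnits (σ := σ.1.1) ?_ ?_ fun i y => ?_
      · have := pow_orderOf_eq_one σ
        rw [hσ] at this
        exact congrArg (fun τ : θ.ker => τ.1.1) this
      · intro h
        have : σ = 1 := Subtype.ext (Subtype.ext h)
        rw [this, orderOf_one] at hσ
        exact hl.one_lt.ne hσ
      · exact twist_mem_oneUnits_of_apply_uniformizer hres (σ ^ i).1.2 hπ ((hker _).1 (σ ^ i).2) y
    have h2 : v (l : K) < 1 := by
      rw [← hW.lt_one_iff hv, map_natCast]; exact h1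
    have h3 : ((l : ℕ) : IsLocalRing.ResidueField v.valuationSubring) = 0 := by
      rw [← map_natCast (IsLocalRing.residue v.valuationSubring), IsLocalRing.residue_eq_zero_iff,
        Valuation.mem_maximalIdeal_iff]
      exact_mod_cast h2
    exact ((Nat.dvd_prime hl).1 (ringChar.dvd h3)).elim
      (fun h => absurd h CharP.ringChar_ne_one) Eq.symm

end WildInertia

/-! ### Extracting a cycle from orbit lengths -/

section GroupAction

open MulAction

/-- A permutation that fixes everything outside the orbit of `x`, which has length `n`, is an
`n`-cycle. -/
theorem isCycleOfLength_of_minimalPeriod {X : Type*} (σ : Equiv.Perm X) (x : X) (n : ℕ)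
    (hn : 0 < n) (hper : Function.minimalPeriod σ x = n)
    (hfix : ∀ y, (∀ i : ℕ, (σ ^ i) x ≠ y) → σ y = y) : IsCycleOfLength σ n := by
  refine ⟨fun i => (σ ^ (i : ℕ)) x, fun i j hij => ?_, fun i => ?_,
    fun y hy => hfix y fun i hi => hy ?_⟩
  · simp only [Equiv.Perm.coe_pow] at hij
    have := (Function.iterate_eq_iterate_iff_of_lt_minimalPeriod
      (hper ▸ i.2) (hper ▸ j.2)).1 hij
    exact Fin.ext this
  · obtain ⟨m, rfl⟩ := Nat.exists_eq_succ_of_ne_zero hn.ne'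
    rw [← Equiv.Perm.mul_apply, ← pow_succ', finRotate_apply]
    simp only [Equiv.Perm.coe_pow]
    rw [← Function.iterate_mod_minimalPeriod_eq, hper, Fin.val_add, Fin.val_one']
    simp
  · refine ⟨⟨i % n, Nat.mod_lt _ hn⟩, ?_⟩
    rw [← hi]
    simp only [Equiv.Perm.coe_pow]
    rw [← hper, Function.iterate_mod_minimalPeriod_eq]

variable {G X : Type*} [Group G] [MulAction G X]

/-- A permutation in a group that acts on the orbit of `x` with full period and fixes everything
else is a cycle. -/
theorem isCycleOfLength_of_period_eq [Finite X] {g : G} {x : X}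
    (hper : MulAction.period g x = Nat.card (orbit G x))
    (hfix : ∀ y ∉ orbit G x, g • y = y) :
    IsCycleOfLength (MulAction.toPerm g : Equiv.Perm X) (Nat.card (orbit G x)) := by
  have : Nonempty (orbit G x) := ⟨⟨x, mem_orbit_self x⟩⟩
  have hmin : Function.minimalPeriod (MulAction.toPerm g : Equiv.Perm X) x =
      Nat.card (orbit G x) := hper
  refine isCycleOfLength_of_minimalPeriod _ x _ Nat.card_pos hmin fun y hy => ?_
  by_cases hyo : y ∈ orbit G x
  · exfalso
    have hpow : ∀ i : ℕ, ((MulAction.toPerm g : Equiv.Perm X) ^ i) x = g ^ i • x := fun i => by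
      rw [← MulAction.toPermHom_apply, ← map_pow]; rfl
    -- Full period makes the powers of `g` applied to `x` distinct, so by counting they exhaust the
    -- orbit.
    let φ : Fin (Nat.card (orbit G x)) → orbit G x := fun i => ⟨g ^ (i : ℕ) • x, _, rfl⟩
    have hφ : Function.Injective φ := fun i j hij => by
      have h1 : g ^ (i : ℕ) • x = g ^ (j : ℕ) • x := congrArg Subtype.val hij
      rw [← hpow, ← hpow] at h1
      simp only [Equiv.Perm.coe_pow] at h1
      exact Fin.ext ((Function.iterate_eq_iterate_iff_of_lt_minimalPeriod
        (i.2.trans_eq hmin.symm) (j.2.trans_eq hmin.symm)).1 h1)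
    have hbij := (Nat.bijective_iff_injective_and_card φ).2 ⟨hφ, by simp⟩
    obtain ⟨i, hi⟩ := hbij.2 ⟨y, hyo⟩
    exact hy i ((hpow i).trans (congrArg Subtype.val hi))
  · exact hfix y hyo

/-- The orbits of a normal subgroup inside an orbit of the group have sizes dividing its size. -/
theorem card_orbit_dvd_of_normal [Finite G] (P : Subgroup G) [P.Normal] (y : X) :
    Nat.card (orbit P y) ∣ Nat.card (orbit G y) := by
  have h1 : (stabilizer G y).relIndex P = Nat.card (orbit P y) := by
    rw [Nat.card_coe_set_eq, ← MulAction.index_stabilizer]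
    rfl
  have h2 : (stabilizer G y).index = Nat.card (orbit G y) := by
    rw [MulAction.index_stabilizer, Nat.card_coe_set_eq]
  rw [← h1, ← h2]
  have h3 := Subgroup.relIndex_mul_index (le_sup_left : stabilizer G y ≤ stabilizer G y ⊔ P)
  -- With `S` the stabilizer: `[SP : S] = [P : S ∩ P]`, while `[SP : S]` divides `[G : S]`.
  have h4 : (stabilizer G y).relIndex (stabilizer G y ⊔ P) = (stabilizer G y).relIndex P := by
    have e1 := Subgroup.relIndex_mul_relIndex (stabilizer G y ⊓ P) _ _ inf_le_left
      (le_sup_left : stabilizer G y ≤ stabilizer G y ⊔ P)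
    have e2 := Subgroup.relIndex_mul_relIndex (stabilizer G y ⊓ P) _ _ inf_le_right
      (le_sup_right : P ≤ stabilizer G y ⊔ P)
    rw [← e2, Subgroup.inf_relIndex_left, Subgroup.inf_relIndex_right,
      Subgroup.relIndex_sup_right, mul_comm] at e1
    exact Nat.eq_of_mul_eq_mul_right (Nat.pos_of_ne_zero Subgroup.index_ne_zero_of_finite) e1
  rw [← h4, ← h3]
  exact dvd_mul_right _ _

/-- If the primes dividing the order of a normal subgroup `P` are all equal to `p`, which does not
divide the size of the orbit of `y`, then `P` fixes `y`. -/
theorem smul_eq_of_not_dvd_card_orbit [Finite G] (P : Subgroup G) [P.Normal] {p : ℕ}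
    (hP : ∀ l : ℕ, l.Prime → l ∣ Nat.card P → l = p) {y : X}
    (hy : ¬ p ∣ Nat.card (orbit G y)) {g : G} (hg : g ∈ P) : g • y = y := by
  have h1 : Nat.card (orbit P y) = 1 := by
    by_contra hne
    obtain ⟨l, hl, hdvd⟩ := Nat.exists_prime_and_dvd hne
    have h2 : Nat.card (orbit P y) ∣ Nat.card P := by
      rw [Nat.card_coe_set_eq, ← MulAction.index_stabilizer]
      exact Subgroup.index_dvd_card _
    have := hP l hl (hdvd.trans h2)
    subst this
    exact hy (hdvd.trans (card_orbit_dvd_of_normal P y))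
  have := (Nat.card_eq_one_iff_unique.1 h1).1
  have h2 := Subsingleton.elim (⟨(⟨g, hg⟩ : P) • y, _, rfl⟩ : orbit P y) ⟨y, mem_orbit_self y⟩
  exact congrArg Subtype.val h2

theorem period_eq_card_orbit_zpowers [Finite X] (c : G) (x : X) :
    MulAction.period c x = Nat.card (orbit (Subgroup.zpowers c) x) := by
  change Function.minimalPeriod (c • ·) x = _
  have := Fintype.ofFinite (orbit (Subgroup.zpowers c) x)
  rw [Nat.card_eq_fintype_card]
  exact MulAction.minimalPeriod_eq_card c x

/-- An element generating `G` modulo a normal subgroup that fixes the orbit of `x` permutes this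
orbit cyclically. -/
theorem period_eq_card_orbit [Finite X] (P : Subgroup G) {c : G}
    (hc : ∀ g : G, ∃ n : ℤ, (c ^ n)⁻¹ * g ∈ P) {x : X} (hx : ∀ g ∈ P, g • x = x) :
    MulAction.period c x = Nat.card (orbit G x) := by
  have : (orbit (Subgroup.zpowers c) x : Set X) = orbit G x := by
    ext y
    constructor
    · rintro ⟨g, rfl⟩
      exact ⟨g, rfl⟩
    · rintro ⟨g, rfl⟩
      obtain ⟨n, hn⟩ := hc g
      refine ⟨⟨c ^ n, n, rfl⟩, ?_⟩
      have := hx _ hn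
      rw [mul_smul, inv_smul_eq_iff] at this
      exact this.symm
  rw [← this, period_eq_card_orbit_zpowers]

/-- The group-theoretic core of the cycle lemma. -/
theorem exists_isCycleOfLength_toPerm [Finite G] [Finite X] (P : Subgroup G) [P.Normal]
    [IsCyclic (G ⧸ P)] {p : ℕ} (hP : ∀ l : ℕ, l.Prime → l ∣ Nat.card P → l = p) (x : X)
    (hother : ∀ y ∉ orbit G x, (Nat.card (orbit G y)).Coprime (Nat.card (orbit G x)) ∧
      ¬ p ∣ Nat.card (orbit G y))
    (hx : (Nat.card (orbit G x)).Prime ∨ ¬ p ∣ Nat.card (orbit G x)) :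
    ∃ g : G, IsCycleOfLength (MulAction.toPerm g : Equiv.Perm X) (Nat.card (orbit G x)) := by
  obtain ⟨c', hc'⟩ := IsCyclic.exists_generator (α := G ⧸ P)
  obtain ⟨c, rfl⟩ := QuotientGroup.mk_surjective c'
  have hc : ∀ g : G, ∃ n : ℤ, (c ^ n)⁻¹ * g ∈ P := fun g => by
    obtain ⟨n, hn⟩ := hc' (g : G ⧸ P)
    exact ⟨n, QuotientGroup.eq.1 hn⟩
  by_cases htriv : ∀ y ∈ orbit G x, ∀ g ∈ P, g • y = y
  · have : Fintype X := Fintype.ofFinite X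
    classical
    -- `c ^ r` fixes all points outside the orbit of `x`; since `r` is coprime to the length of that
    -- orbit, `c ^ r` keeps its full period there.
    set r := ∏ y ∈ Finset.univ.filter (· ∉ orbit G x), Nat.card (orbit G y) with hr
    have hcop : r.Coprime (Nat.card (orbit G x)) :=
      Nat.Coprime.prod_left fun y hy => (hother y (Finset.mem_filter.1 hy).2).1
    have hper : MulAction.period c x = Nat.card (orbit G x) :=
      period_eq_card_orbit P hc (htriv x (mem_orbit_self x))
    refine ⟨c ^ r, isCycleOfLength_of_period_eq ?_ fun y hy => ?_⟩
    · rw [← hper] at hcop ⊢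
      have hmem : x ∈ Function.periodicPts (c • · : X → X) :=
        Function.minimalPeriod_pos_iff_mem_periodicPts.1
          (MulAction.period_pos_of_orderOf_pos (orderOf_pos c) x)
      have := Function.minimalPeriod_iterate_eq_div_gcd' (n := r) hmem
      rw [smul_iterate] at this
      refine this.trans ?_
      change MulAction.period c x / Nat.gcd (MulAction.period c x) r = _
      rw [Nat.gcd_comm, show Nat.gcd r (MulAction.period c x) = 1 from hcop, Nat.div_one]
    · have hdvd : MulAction.period c y ∣ r := by
        rw [period_eq_card_orbit P hc fun g hg =>
          smul_eq_of_not_dvd_card_orbit P hP (hother y hy).2 hg]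
        exact Finset.dvd_prod_of_mem _ (by simp [hy])
      exact (MulAction.pow_smul_eq_iff_period_dvd).2 hdvd
  · push Not at htriv
    obtain ⟨y, hy, g, hg, hgy⟩ := htriv
    have horb : orbit G y = orbit G x := orbit_eq_iff.2 hy
    have hp : p ∣ Nat.card (orbit G x) := by
      by_contra h
      rw [← horb] at h
      exact hgy (smul_eq_of_not_dvd_card_orbit P hP h hg)
    have hprime := hx.resolve_right (not_not.2 hp)
    have h1 : MulAction.period g y ≠ 1 := fun h => hgy (by
      have := MulAction.pow_period_smul g y
      rwa [h, pow_one] at this)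
    -- A prime `l` dividing the period of `g` at `y` divides `|P|`, so `l = p`, which is the length
    -- of the orbit. The period is then at least this length, and it cannot exceed it.
    obtain ⟨l, hl, hdvd⟩ := Nat.exists_prime_and_dvd h1
    obtain rfl : l = p :=
      hP l hl ((hdvd.trans (MulAction.period_dvd_orderOf g y)).trans
        (Subgroup.orderOf_dvd_natCard P hg))
    have hcard : l = Nat.card (orbit G x) := (Nat.prime_dvd_prime_iff_eq hl hprime).1 hp
    rw [← horb] at hother hcard ⊢
    refine ⟨g, isCycleOfLength_of_period_eq (le_antisymm ?_ ?_) fun z hz =>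
      smul_eq_of_not_dvd_card_orbit P hP (hother z hz).2 hg⟩
    · rw [period_eq_card_orbit_zpowers]
      refine Nat.card_mono (Set.toFinite _) ?_
      rintro _ ⟨h, rfl⟩
      exact ⟨h, rfl⟩
    · rw [← hcard]
      exact Nat.le_of_dvd (MulAction.period_pos_of_orderOf_pos (orderOf_pos g) y) hdvd

end GroupAction

/-! ### Restricting valuations to intermediate fields -/

section Restriction

/-- A nontrivial `ℤᵐ⁰`-valued valuation of a field is equivalent to a surjective one. -/
theorem Valuation.exists_surjective_isEquiv {L : Type*} [Field L] (V : Valuation L ℤᵐ⁰)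
    (hV : ∃ x, 1 < V x) :
    ∃ w : Valuation L ℤᵐ⁰, Function.Surjective w ∧ ∀ x, w x ≤ 1 ↔ V x ≤ 1 := by
  obtain ⟨x, hx⟩ := hV
  have hx0 : V x ≠ 0 := (zero_lt_one.trans hx).ne'
  have : Nontrivial (MonoidWithZeroHom.valueGroup (.ofClass V)) := by
    refine ⟨⟨⟨Units.mk0 (V x) hx0, ?_⟩, 1, fun h => ?_⟩⟩
    · exact MonoidWithZeroHom.mem_valueGroup _ ⟨x, rfl⟩
    · have := congrArg (fun u => ((u : (ℤᵐ⁰)ˣ) : ℤᵐ⁰)) (congrArg Subtype.val h)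
      exact hx.ne' this
  have : IsCyclic (MonoidWithZeroHom.valueGroup (.ofClass V)) := inferInstance
  let e := Valuation.IsRankOneDiscrete.valueGroup₀_equiv_withZeroMulInt V
  -- Renormalization: the value group is a nontrivial subgroup of `ℤ`, hence isomorphic to `ℤ` as an
  -- ordered group.
  refine ⟨V.restrict.map
    ⟨⟨e, map_zero e⟩, map_one e, map_mul e⟩ (OrderHomClass.mono e), ?_, fun x => ?_⟩
  · exact e.surjective.comp (MonoidWithZeroHom.ValueGroup₀.restrict₀_surjective _)
  · rw [← V.restrict_le_one_iff, ← map_le_map_iff e, map_one]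
    rfl

variable {K L N : Type*} [Field K] [Field L] [Field N] [Algebra K L]
    [Algebra L N] [Algebra K N] [IsScalarTower K L N] {v : Valuation K ℤᵐ⁰} {W : Valuation N ℤᵐ⁰}

/-- A discrete extension of `v` induces one on every intermediate field. -/
theorem exists_isDiscreteExtension_isDiscreteExtension (hv : Function.Surjective v)
    (hW : IsDiscreteExtension v W) :
    ∃ w : Valuation L ℤᵐ⁰, IsDiscreteExtension v w ∧ IsDiscreteExtension w W := by
  obtain ⟨a, ha⟩ := hv (WithZero.exp 1)
  have ha1 : 1 < v a := by rw [ha, ← WithZero.exp_zero, WithZero.exp_lt_exp]; norm_num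
  obtain ⟨w, hw, h⟩ := (W.comap (algebraMap L N)).exists_surjective_isEquiv
    ⟨algebraMap K L a, by
      rw [Valuation.comap_apply, ← IsScalarTower.algebraMap_apply, ← not_le, hW.le_one_iff, not_le]
      exact ha1⟩
  refine ⟨w, isDiscreteExtension_iff.2 ⟨hw, fun a => ?_⟩,
    isDiscreteExtension_iff.2 ⟨hW.surjective, fun x => (h x).symm⟩⟩
  rw [h, Valuation.comap_apply, ← IsScalarTower.algebraMap_apply, hW.le_one_iff]

end Restriction

/-! ### Orbits of the decomposition group on embeddings of `L` -/

section Orbits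

variable {K L N : Type*} [Field K] [Field L] [Field N] [Algebra K L] [Algebra K N]
  [FiniteDimensional K N] [IsGalois K N] {v : Valuation K ℤᵐ⁰} {W : Valuation N ℤᵐ⁰}

/-- The stabilizer in the decomposition group of the image of a primitive element of `L` has
index the reduced ramification exponent of the induced valuation of `L`. -/
theorem card_stabilizer_mul_reducedRamificationExponent (hv : Function.Surjective v)
    (hW : IsDiscreteExtension v W)
    (hres : ∀ x, W x ≤ 1 → ∃ a : K, W (x - algebraMap K N a) < 1)
    {α : L} (hL : IntermediateField.adjoin K {α} = ⊤) (ι : L →ₐ[K] N) {w : Valuation L ℤᵐ⁰}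
    (hw : Function.Surjective w) (hwW : ∀ x, W (ι x) ≤ 1 ↔ w x ≤ 1) :
    Nat.card (MulAction.stabilizer (W.decompositionGroup K) (ι α)) *
      reducedRamificationExponent v w = Nat.card (W.decompositionGroup K) := by
  let : Algebra L N := ι.toRingHom.toAlgebra
  have : IsScalarTower K L N := IsScalarTower.of_algebraMap_eq fun x => (ι.commutes x).symm
  have : FiniteDimensional L N := FiniteDimensional.right K L N
  have : IsGalois L N := IsGalois.tower_top_of_isGalois K L N
  have hwW' : IsDiscreteExtension w W := isDiscreteExtension_iff.2 ⟨hW.surjective, hwW⟩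
  have hvw : IsDiscreteExtension v w := isDiscreteExtension_iff.2 ⟨hw, fun a => by
    rw [← hwW, ι.commutes, hW.le_one_iff]⟩
  -- Representatives in `K` also serve as representatives in `L`, so the decomposition group over
  -- `L` can be counted in the same way.
  have hresL : ∀ x, W x ≤ 1 → ∃ a : L, W (x - algebraMap L N a) < 1 := fun x hx => by
    obtain ⟨a, ha⟩ := hres x hx
    exact ⟨algebraMap K L a, by rwa [← IsScalarTower.algebraMap_apply]⟩
  have hcard : Nat.card (MulAction.stabilizer (W.decompositionGroup K) (ι α)) =
      Nat.card (W.decompositionGroup L) := by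
    have hfix : ∀ σ : N ≃ₐ[K] N, σ (ι α) = ι α → ∀ x : L, σ (ι x) = ι x := fun σ hσ x => by
      have hx : x ∈ IntermediateField.adjoin K {α} := hL ▸ IntermediateField.mem_top
      induction hx using IntermediateField.adjoin_induction with
      | mem x hx => rw [Set.mem_singleton_iff.1 hx, hσ]
      | algebraMap x => rw [ι.commutes, σ.commutes]
      | add x y _ _ hx hy => rw [map_add, map_add, hx, hy]
      | inv x _ hx => rw [map_inv₀, map_inv₀, hx]
      | mul x y _ _ hx hy => rw [map_mul, map_mul, hx, hy]
    refine Nat.card_congr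
      { toFun := fun σ => ⟨AlgEquiv.ofRingEquiv (f := (σ.1.1 : N ≃+* N)) (hfix σ.1.1 σ.2), σ.1.2⟩
        invFun := fun σ => ⟨⟨σ.1.restrictScalars K, σ.2⟩, σ.1.commutes α⟩
        left_inv := fun σ => rfl
        right_inv := fun σ => rfl }
  rw [hcard, card_decompositionGroup hw hwW' hresL, card_decompositionGroup hv hW hres, mul_comm,
    reducedRamificationExponent_mul hv hvw hwW']

/-- Embeddings of `L` that induce the same valuation are conjugate under the decomposition
group. -/
theorem exists_mem_decompositionGroup_apply_eq (hW : Function.Surjective W)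
    (ι ι' : L →ₐ[K] N) {w : Valuation L ℤᵐ⁰} (hw : Function.Surjective w)
    (h : ∀ x, W (ι x) ≤ 1 ↔ w x ≤ 1) (h' : ∀ x, W (ι' x) ≤ 1 ↔ w x ≤ 1) :
    ∃ σ ∈ W.decompositionGroup K, ∀ x, σ (ι x) = ι' x := by
  let : Algebra L N := ι.toRingHom.toAlgebra
  have : IsScalarTower K L N := IsScalarTower.of_algebraMap_eq fun x => (ι.commutes x).symm
  have : FiniteDimensional L N := FiniteDimensional.right K L N
  have : IsGalois L N := IsGalois.tower_top_of_isGalois K L N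
  obtain ⟨ρ, hρ⟩ : ∃ ρ : N ≃ₐ[K] N, ∀ x, ρ (ι x) = ι' x :=
    ⟨AlgEquiv.ofBijective (ι'.liftNormal N) (AlgHom.normal_bijective K N N _),
      ι'.liftNormal_commutes N⟩
  have hW' : Function.Surjective (W.comap (ρ : N →+* N)) := hW.comp ρ.surjective
  -- Any `ρ` carrying `ι` to `ι'` may move `W`, but `W` and `W ∘ ρ` both extend `w`. An automorphism
  -- `τ` over `L` matches them, and `ρ * τ` then preserves `W` while still carrying `ι` to `ι'`.
  obtain ⟨τ, hτ⟩ := exists_algEquiv_apply_eq (F := L) (v := w) (W := W)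
    (W' := W.comap (ρ : N →+* N)) hw (isDiscreteExtension_iff.2 ⟨hW, h⟩)
    (isDiscreteExtension_iff.2 ⟨hW', fun x => by
      rw [← h', ← hρ]; rfl⟩)
  refine ⟨ρ * τ.restrictScalars K, fun x => hτ x, fun x => ?_⟩
  rw [AlgEquiv.mul_apply, ← hρ]
  exact congrArg ρ (τ.commutes x)

end Orbits

/-! ### Roots, embeddings and the main theorem -/

section Assembly

open Polynomial

/-- A simple extension embeds into every field containing a root of the minimal polynomial. -/
theorem exists_algHom_apply_eq_of_adjoin_eq_top {K L N : Type*} [Field K] [Field L] [Field N]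
    [Algebra K L] [Algebra K N] {f : K[X]} (hmonic : f.Monic) (hirr : Irreducible f) {α : L}
    (hα : aeval α f = 0) (hL : IntermediateField.adjoin K {α} = ⊤) {β : N} (hβ : aeval β f = 0) :
    ∃ ι : L →ₐ[K] N, ι α = β := by
  have hint : IsIntegral K α := ⟨f, hmonic, hα⟩
  have hmin : minpoly K α = f := (minpoly.eq_of_irreducible_of_monic hirr hα hmonic).symm
  let pb := IntermediateField.adjoin.powerBasis hint
  have hgen : minpoly K pb.gen = f := by
    rw [← hmin]; exact IntermediateField.minpoly_gen K α
  let e := (IntermediateField.equivOfEq hL).trans IntermediateField.topEquiv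
  have hβ' : aeval β (minpoly K pb.gen) = 0 := by rw [hgen, hβ]
  refine ⟨(pb.lift β hβ').comp e.symm.toAlgHom, ?_⟩
  have he : e.symm α = pb.gen := by
    rw [AlgEquiv.symm_apply_eq]; rfl
  change pb.lift β hβ' (e.symm α) = β
  rw [he, PowerBasis.lift_gen]

theorem Polynomial.Gal.smul_eq_iff {K E : Type*} [Field K] [Field E] [Algebra K E] {f : K[X]}
    [Fact ((f.map (algebraMap K E)).Splits)] (σ : f.Gal) (x y : f.rootSet E) :
    σ • x = y ↔ σ ((Gal.rootsEquivRoots f E).symm x : f.SplittingField) =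
      (Gal.rootsEquivRoots f E).symm y := by
  rw [Gal.smul_def, ← Equiv.eq_symm_apply, Subtype.ext_iff]
  rfl

end Assembly

theorem mainTheorem7 {K : Type*} [Field K] (f : Polynomial K) (hmonic : f.Monic)
    (hirr : Irreducible f) (hsep : f.Separable)
    -- the discrete valuation
    (v : Valuation K ℤᵐ⁰) (hv : Function.Surjective v)
    (hclosed : IsAlgClosed (IsLocalRing.ResidueField v.valuationSubring))
    (hchar : ringChar (IsLocalRing.ResidueField v.valuationSubring) = ringChar K)
    -- the root field
    {L : Type*} [Field L] [Algebra K L] (α : L) (hα : Polynomial.aeval α f = 0)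
    (hL : IntermediateField.adjoin K {α} = ⊤)
    -- the chosen extension and the conditions on the exponents
    (w₁ : Valuation L ℤᵐ⁰) (hw₁ : IsDiscreteExtension v w₁)
    (hothers : ∀ w : Valuation L ℤᵐ⁰, IsDiscreteExtension v w → w ≠ w₁ →
      (reducedRamificationExponent v w).Coprime (reducedRamificationExponent v w₁) ∧
        ¬ ringChar K ∣ reducedRamificationExponent v w)
    (hfirst : (reducedRamificationExponent v w₁).Prime ∨
      ¬ ringChar K ∣ reducedRamificationExponent v w₁)
    -- any overfield in which `f` splits, whose roots the Galois group permutes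
    {E : Type*} [Field E] [Algebra K E]
    [hE : Fact ((f.map (algebraMap K E)).Splits)] :
    ∃ σ ∈ (Polynomial.Gal.galActionHom f E).range,
      IsCycleOfLength σ (reducedRamificationExponent v w₁) := by
  have hgal : IsGalois K f.SplittingField := IsGalois.of_separable_splitting_field hsep
  -- Valuations are studied on the splitting field only; `β` transports the roots in `E` there,
  -- compatibly with the Galois action.
  let β : f.rootSet E → f.SplittingField := fun y => (Polynomial.Gal.rootsEquivRoots f E).symm y
  have hβ : ∀ y, Polynomial.aeval (β y) f = 0 := fun y =>
    (Polynomial.mem_rootSet.1 ((Polynomial.Gal.rootsEquivRoots f E).symm y).2).2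
  have hemb := fun y => exists_algHom_apply_eq_of_adjoin_eq_top hmonic hirr hα hL (hβ y)
  choose ι hι using hemb
  obtain ⟨y₁⟩ : Nonempty (f.rootSet E) := by
    obtain ⟨z, hz⟩ := hE.out.exists_eval_eq_zero (by
      rw [Polynomial.degree_map]; exact (Polynomial.degree_pos_of_irreducible hirr).ne')
    exact ⟨⟨z, Polynomial.mem_rootSet.2 ⟨hirr.ne_zero, by
      rwa [Polynomial.eval_map_algebraMap] at hz⟩⟩⟩
  -- Extending `w₁` itself along `ι y₁`, rather than `v`, makes `y₁` a root whose induced valuation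
  -- is `w₁`.
  obtain ⟨W, hW, hW₁⟩ : ∃ W : Valuation f.SplittingField ℤᵐ⁰, IsDiscreteExtension v W ∧
      ∀ x, W (ι y₁ x) ≤ 1 ↔ w₁ x ≤ 1 := by
    let : Algebra L f.SplittingField := (ι y₁).toRingHom.toAlgebra
    have : IsScalarTower K L f.SplittingField :=
      IsScalarTower.of_algebraMap_eq fun x => ((ι y₁).commutes x).symm
    have : FiniteDimensional L f.SplittingField := FiniteDimensional.right K L _
    have : IsGalois L f.SplittingField := IsGalois.tower_top_of_isGalois K L _
    obtain ⟨W, hW⟩ := exists_isDiscreteExtension f.SplittingField hw₁.surjective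
    exact ⟨W, hw₁.trans hW, hW.le_one_iff⟩
  have hres := exists_sub_lt_one_of_isAlgClosed hv hW
  have hex : ∀ y, ∃ w : Valuation L ℤᵐ⁰, IsDiscreteExtension v w ∧
      ∀ x, W (ι y x) ≤ 1 ↔ w x ≤ 1 := fun y => by
    let : Algebra L f.SplittingField := (ι y).toRingHom.toAlgebra
    have : IsScalarTower K L f.SplittingField :=
      IsScalarTower.of_algebraMap_eq fun x => ((ι y).commutes x).symm
    obtain ⟨w, hw, hwW⟩ := exists_isDiscreteExtension_isDiscreteExtension (L := L) hv hW
    exact ⟨w, hw, hwW.le_one_iff⟩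
  let D : Subgroup f.Gal := W.decompositionGroup K
  have horb : ∀ (y : f.rootSet E) (w : Valuation L ℤᵐ⁰), Function.Surjective w →
      (∀ x, W (ι y x) ≤ 1 ↔ w x ≤ 1) →
      Nat.card (MulAction.orbit D y) = reducedRamificationExponent v w := fun y w hw h => by
    have h1 := card_stabilizer_mul_reducedRamificationExponent hv hW hres hL (ι y) hw h
    have h2 : Nat.card (MulAction.stabilizer D y) =
        Nat.card (MulAction.stabilizer (W.decompositionGroup K) (ι y α)) := by
      refine Nat.card_congr (Equiv.subtypeEquivRight fun σ => ?_)
      rw [hι]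
      exact Polynomial.Gal.smul_eq_iff σ.1 y y
    have h3 := Nat.card_congr (MulAction.orbitProdStabilizerEquivGroup D y)
    rw [Nat.card_prod, mul_comm, h2] at h3
    exact Nat.eq_of_mul_eq_mul_left Nat.card_pos (h3.trans h1.symm)
  have hne : ∀ (y : f.rootSet E) (w : Valuation L ℤᵐ⁰), y ∉ MulAction.orbit D y₁ →
      (∀ x, W (ι y x) ≤ 1 ↔ w x ≤ 1) → w ≠ w₁ := by
    rintro y w hy h rfl
    obtain ⟨σ, hσ, hσι⟩ := exists_mem_decompositionGroup_apply_eq hW.surjective (ι y₁) (ι y)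
      hw₁.surjective hW₁ h
    refine hy ⟨⟨σ, hσ⟩, (Polynomial.Gal.smul_eq_iff _ _ _).2 ?_⟩
    have := hσι α
    rw [hι, hι] at this
    exact this
  obtain ⟨P, hPn, hPc, hP⟩ : ∃ (P : Subgroup D) (_ : P.Normal), IsCyclic (D ⧸ P) ∧
      ∀ l : ℕ, l.Prime → l ∣ Nat.card P →
        l = ringChar (IsLocalRing.ResidueField v.valuationSubring) :=
    exists_normal_isCyclic_quotient hv hW hres
  have horb₁ := horb y₁ w₁ hw₁.surjective hW₁
  -- The hypotheses on exponents become hypotheses on orbit lengths, with the characteristic of `K`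
  -- replaced by that of the residue field, which governs `P`.
  rw [← horb₁] at hothers hfirst ⊢
  rw [← hchar] at hothers hfirst
  obtain ⟨g, hg⟩ := exists_isCycleOfLength_toPerm (G := D) (X := f.rootSet E) P hP y₁
    (fun y hy => by
      obtain ⟨w, hw, h⟩ := hex y
      rw [horb y w hw.surjective h]
      exact hothers w hw (hne y w hy h)) hfirst
  exact ⟨_, ⟨g.1, rfl⟩, hg⟩
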